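/- **Model.** A circuit over a field $\mathbb F$ is a straight-line program with fan-in-two gates and unbounded fan-out. In the *linear* model its gates are additions, subtractions, and multiplications by fixed scalars of $\mathbb F$; in the *arithmetic* model it may also use constants of $\mathbb F$ and products of two computed values. Its operation count is the number of its gates, where multiplications by the scalars $0$, $1$, $-1$ and constants are free. Fix one of the two models; it is used for all circuits below. For $N=2^k$, $k\ge 0$, let $H_N$ be the Walsh–Hadamard matrix, given by $H_1=[1]$ and $H_{2N}=\begin{bmatrix}H_N&H_N\\H_N&-H_N\end{bmatrix}$, and let $F_N=(\omega_N^{ab})_{0\le a,b<N}$ with $\omega_N=e^{-2\pi i/N}$ be the DFT matrix. Computing the WHT of length $N$ over $\mathbb R$ with $T$ operations means that a circuit over $\mathbb R$ with operation count $T$ maps $x$ to $H_Nx$ for all $x\in\mathbb R^N$. Computing the DFT of length $N$ with $T$ real operations means that a circuit over $\mathbb R$ with operation count $T$ maps the $2N$ real and imaginary parts of the entries of $y$ to those of $F_Ny$, for all $y\in\mathbb C^N$. Let $\log$ be the logarithm to base $2$. **Lemma.** Let $c\in\mathbb R$, and suppose that for $N$ ranging over the powers of $2$ the WHT of length $N$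 over $\mathbb R$ can be computed with at most $cN\log N+O(N)$ operations. Then, for $N$ ranging over the powers of $2$, the DFT of length $N$ can be computed with at most $$\left(\tfrac23c+\tfrac{28}{9}\right)N\log N+O(N)$$ real operations. In particular, the hypothesis holds with $c=1$, so the DFT of length $N$ can be computed with at most $\tfrac{34}{9}N\log N+O(N)$ real operations. -/

import Mathlib

/-- A gate of fan-in at most two over the field `K`, reading from wires indexed by `ι`. -/
inductive Gate (K ι : Type) : Type
  | add (i j : ι)
  | sub (i j : ι)
  | smul (a : K) (i : ι)
  | mul (i j : ι)
  | const (a : K)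

/-- The value that a gate produces when the wires carry the values `v`. -/
def Gate.eval {K ι : Type} [Field K] : Gate K ι → (ι → K) → K
  | .add i j, v => v i + v j
  | .sub i j, v => v i - v j
  | .smul a i, v => a * v i
  | .mul i j, v => v i * v j
  | .const a, _ => a

open Classical in
/-- Every addition, subtraction and multiplication is one operation, except that multiplications
by the fixed scalars `0`, `1` and `-1` are free; constants are available for free. -/
noncomputable def Gate.cost {K ι : Type} [Field K] : Gate K ι → ℕ
  | .add _ _ => 1
  | .sub _ _ => 1
  | .smul a _ => if a = 0 ∨ a = 1 ∨ a = -1 then 0 else 1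
  | .mul _ _ => 1
  | .const _ => 0

/-- The linear gates are additions, subtractions and multiplications by fixed scalars. -/
def Gate.IsLinear {K ι : Type} : Gate K ι → Prop
  | .add _ _ => True
  | .sub _ _ => True
  | .smul _ _ => True
  | .mul _ _ => False
  | .const _ => False

/-- An arithmetic circuit (straight-line program) over `K` with outputs indexed by `κ`, in a
state where the wires indexed by `ι` are available. Either it stops, and each output is one of the
available wires, or it performs a gate and goes on with one more wire: the new wire is `none`, and
the old ones are `some i`. Wires may be read any number of times. -/
inductive Circuit (K κ : Type) : Type → Type 1
  | out {ι : Type} (o : κ → ι) : Circuit K κ ι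
  | gate {ι : Type} (g : Gate K ι) (rest : Circuit K κ (Option ι)) : Circuit K κ ι

/-- The output vector of a circuit on the input vector `v`. -/
def Circuit.eval {K κ : Type} [Field K] : {ι : Type} → Circuit K κ ι → (ι → K) → κ → K
  | _, .out o, v => fun k => v (o k)
  | _, .gate g rest, v => rest.eval (fun w => w.elim (g.eval v) v)

/-- The number of operations that a circuit performs. -/
noncomputable def Circuit.cost {K κ : Type} [Field K] : {ι : Type} → Circuit K κ ι → ℕ
  | _, .out _ => 0
  | _, .gate g rest => g.cost + rest.cost

/-- All gates of the circuit are linear. -/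
def Circuit.IsLinear {K κ : Type} : {ι : Type} → Circuit K κ ι → Prop
  | _, .out _ => True
  | _, .gate g rest => g.IsLinear ∧ rest.IsLinear

/-- The two usual models: linear circuits (additions, subtractions and multiplications by fixed
scalars), and arithmetic circuits (which may also use constants and products of two wires). -/
inductive CircuitModel : Type
  | linear
  | arithmetic

/-- The circuit uses only gates of the given model. -/
def Circuit.InModel {K κ ι : Type} (M : CircuitModel) (A : Circuit K κ ι) : Prop :=
  match M with
  | .linear => A.IsLinear
  | .arithmetic => True

/-- The index set of size `2 ^ (k + 1)` as a first half followed by a second half. -/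
def halves (k : ℕ) : Fin (2 ^ k) ⊕ Fin (2 ^ k) ≃ Fin (2 ^ (k + 1)) :=
  finSumFinEquiv.trans (finCongr (by rw [pow_succ, mul_two]))

/-- The Walsh-Hadamard matrix of size `2 ^ k`. -/
def walshHadamard (K : Type) [Field K] : (k : ℕ) → Matrix (Fin (2 ^ k)) (Fin (2 ^ k)) K
  | 0 => 1
  | k + 1 => Matrix.reindex (halves k) (halves k)
      (Matrix.fromBlocks (walshHadamard K k) (walshHadamard K k)
        (walshHadamard K k) (-walshHadamard K k))

/-- The matrix of the discrete Fourier transform of length `N`, with entries `ω ^ (a * b)` for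
`ω = exp (-2 π i / N)`. -/
noncomputable def dftMatrix (N : ℕ) : Matrix (Fin N) (Fin N) ℂ :=
  fun a b => Complex.exp (-2 * Real.pi * Complex.I / N) ^ (a.val * b.val)

/-- A complex vector as the list of its real parts followed by the list of its imaginary parts. -/
def reIm {N : ℕ} (x : Fin N → ℂ) : Fin N ⊕ Fin N → ℝ :=
  Sum.elim (fun j => (x j).re) (fun j => (x j).im)

/-- The Walsh-Hadamard transform of vectors in `K ^ N`, for `N = 2 ^ k`, can be computed with
`c * N * log₂ N + O(N)` operations of the field `K`. -/
def WHTComputable (M : CircuitModel) (K : Type) [Field K] (c : ℝ) : Prop :=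
  ∃ C : ℝ, ∀ k : ℕ, ∃ A : Circuit K (Fin (2 ^ k)) (Fin (2 ^ k)),
    A.InModel M ∧
    (∀ x : Fin (2 ^ k) → K, A.eval x = (walshHadamard K k).mulVec x) ∧
    (A.cost : ℝ) ≤ c * 2 ^ k * k + C * 2 ^ k

/-- The discrete Fourier transform of vectors in `ℂ ^ N`, for `N = 2 ^ k`, can be computed with
`c * N * log₂ N + O(N)` real operations. -/
def DFTComputable (M : CircuitModel) (c : ℝ) : Prop :=
  ∃ C : ℝ, ∀ k : ℕ, ∃ A : Circuit ℝ (Fin (2 ^ k) ⊕ Fin (2 ^ k)) (Fin (2 ^ k) ⊕ Fin (2 ^ k)),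
    A.InModel M ∧
    (∀ x : Fin (2 ^ k) → ℂ, A.eval (reIm x) = reIm ((dftMatrix (2 ^ k)).mulVec x)) ∧
    (A.cost : ℝ) ≤ c * 2 ^ k * k + C * 2 ^ k

/-! The transform is computed by the split-radix recursion with conjugate twiddle factors. If `U` is
the transform of the even inputs and `Z`, `Z'` are those of the inputs at positions congruent to `1`
and `-1` modulo four, then output `k` is `U k + ω ^ k * Z k + ω ^ (-k) * Z' k`. With `θ` the angle
of `ω ^ (-k)`, this equals `U + cos θ * (Z + Z') - i * sin θ * (Z - Z')` at `k`.

The sum and the difference commute with the smaller transforms, so at every level they can be moved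
to the inputs (`splitFourier_splitButterfly`). The input stage `B` then satisfies `B (n+2) = B (n+1)
⊕ (H_2 ⊗ B n)`. Tensoring with Walsh-Hadamard matrices shows that it is a direct sum of such
transforms, whose logarithmic sizes average about `n / 3` over the points
(`computes_walshHadamard_splitButterfly`). Run on real and imaginary parts, it contributes `2/3 *
c`.

In the remaining stage, dividing the outputs by a product of cosines leaves only the factor `tan θ`
in place of `cos θ` and `sin θ`. The even half has to be scaled for a longer transform, so the
scalings form a small system of recursions (`scaledFourier_add_two`), which is solved with slope
`28/9` (`realComputes_scaledFourier`). Undoing the final scaling costs `O(N)`. -/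

/-! ### Composition of circuits -/

/-- Rename the wires that a gate reads. -/
def Gate.map {K ι ι' : Type} (r : ι → ι') : Gate K ι → Gate K ι'
  | .add i j => .add (r i) (r j)
  | .sub i j => .sub (r i) (r j)
  | .smul a i => .smul a (r i)
  | .mul i j => .mul (r i) (r j)
  | .const a => .const a

theorem Gate.eval_map {K ι ι' : Type} [Field K] (r : ι → ι') (g : Gate K ι) (v : ι' → K) :
    (g.map r).eval v = g.eval (v ∘ r) := by
  cases g <;> rfl

theorem Gate.cost_map {K ι ι' : Type} [Field K] (r : ι → ι') (g : Gate K ι) :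
    (g.map r).cost = g.cost := by
  cases g <;> rfl

theorem Gate.IsLinear.map {K ι ι' : Type} (r : ι → ι') {g : Gate K ι} (h : g.IsLinear) :
    (g.map r).IsLinear := by
  cases g <;> exact h

/-- Rename the input wires of a circuit. -/
def Circuit.map {K κ : Type} : {ι ι' : Type} → (ι → ι') → Circuit K κ ι → Circuit K κ ι'
  | _, _, r, .out o => .out (r ∘ o)
  | _, _, r, .gate g rest => .gate (g.map r) (rest.map (Option.map r))

theorem Circuit.eval_map {K κ ι ι' : Type} [Field K] (r : ι → ι') (A : Circuit K κ ι)
    (v : ι' → K) : (A.map r).eval v = A.eval (v ∘ r) := by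
  induction A generalizing ι' with
  | out o => rfl
  | gate g rest ih =>
    simp only [Circuit.map, Circuit.eval, ih, Gate.eval_map]
    congr 1
    funext w
    cases w <;> rfl

theorem Circuit.cost_map {K κ ι ι' : Type} [Field K] (r : ι → ι') (A : Circuit K κ ι) :
    (A.map r).cost = A.cost := by
  induction A generalizing ι' with
  | out o => rfl
  | gate g rest ih => simp only [Circuit.map, Circuit.cost, ih, Gate.cost_map]

theorem Circuit.IsLinear.map {K κ ι ι' : Type} (r : ι → ι') {A : Circuit K κ ι}
    (h : A.IsLinear) : (A.map r).IsLinear := by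
  induction A generalizing ι' with
  | out o => trivial
  | gate g rest ih => exact ⟨h.1.map r, ih _ h.2⟩

/-- Run the circuit `A`, then the circuit `B` on the outputs and the inputs of `A`. -/
def Circuit.bind {K κ κ' : Type} :
    {ι : Type} → Circuit K κ ι → Circuit K κ' (κ ⊕ ι) → Circuit K κ' ι
  | _, .out o, B => B.map (Sum.elim o id)
  | _, .gate g rest, B => .gate g (rest.bind (B.map (Sum.map id some)))

theorem Circuit.eval_bind {K κ κ' ι : Type} [Field K] (A : Circuit K κ ι)
    (B : Circuit K κ' (κ ⊕ ι)) (v : ι → K) :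
    (A.bind B).eval v = B.eval (Sum.elim (A.eval v) v) := by
  induction A with
  | out o =>
    simp only [Circuit.bind, Circuit.eval_map]
    congr 1
    funext w
    cases w <;> rfl
  | gate g rest ih =>
    simp only [Circuit.bind, Circuit.eval, ih, Circuit.eval_map]
    congr 1
    funext w
    cases w <;> rfl

theorem Circuit.cost_bind {K κ κ' ι : Type} [Field K] (A : Circuit K κ ι)
    (B : Circuit K κ' (κ ⊕ ι)) : (A.bind B).cost = A.cost + B.cost := by
  induction A with
  | out o => simp [Circuit.bind, Circuit.cost, Circuit.cost_map]
  | gate g rest ih => simp only [Circuit.bind, Circuit.cost, ih, Circuit.cost_map, add_assoc]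

theorem Circuit.IsLinear.bind {K κ κ' ι : Type} {A : Circuit K κ ι}
    {B : Circuit K κ' (κ ⊕ ι)} (hA : A.IsLinear) (hB : B.IsLinear) : (A.bind B).IsLinear := by
  induction A with
  | out o => exact hB.map _
  | gate g rest ih => exact ⟨hA.1, ih hA.2 (hB.map _)⟩

theorem Circuit.InModel.bind {M : CircuitModel} {K κ κ' ι : Type} {A : Circuit K κ ι}
    {B : Circuit K κ' (κ ⊕ ι)} (hA : A.InModel M) (hB : B.InModel M) : (A.bind B).InModel M := by
  cases M
  · exact Circuit.IsLinear.bind hA hB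
  · trivial

theorem Circuit.InModel.map {M : CircuitModel} {K κ ι ι' : Type} (r : ι → ι')
    {A : Circuit K κ ι} (hA : A.InModel M) : (A.map r).InModel M := by
  cases M
  · exact Circuit.IsLinear.map r hA
  · trivial

theorem Circuit.IsLinear.inModel {K κ ι : Type} {A : Circuit K κ ι} (h : A.IsLinear)
    (M : CircuitModel) : A.InModel M := by
  cases M
  · exact h
  · trivial

theorem Circuit.out_inModel {K κ ι : Type} (o : κ → ι) (M : CircuitModel) :
    (Circuit.out o : Circuit K κ ι).InModel M := by
  cases M <;> trivial

/-- Some circuit of the model `M` computes the map `f` with at most `T` operations. -/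
def Computes (M : CircuitModel) {K ι κ : Type} [Field K] (f : (ι → K) → κ → K) (T : ℝ) : Prop :=
  ∃ A : Circuit K κ ι, A.InModel M ∧ (∀ x, A.eval x = f x) ∧ (A.cost : ℝ) ≤ T

namespace Computes

variable {M : CircuitModel} {K ι κ κ' : Type} [Field K]

theorem mono {f : (ι → K) → κ → K} {S T : ℝ} (h : Computes M f S) (hST : S ≤ T) :
    Computes M f T := by
  obtain ⟨A, hA, hf, hc⟩ := h
  exact ⟨A, hA, hf, hc.trans hST⟩

theorem wire (o : κ → ι) : Computes M (fun (x : ι → K) k => x (o k)) 0 :=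
  ⟨.out o, Circuit.out_inModel o M, fun _ => rfl, by simp [Circuit.cost]⟩

theorem bind {f : (ι → K) → κ → K} {g : (κ ⊕ ι → K) → κ' → K} {S T : ℝ}
    (hf : Computes M f S) (hg : Computes M g T) :
    Computes M (fun x => g (Sum.elim (f x) x)) (S + T) := by
  obtain ⟨A, hA, hfA, hcA⟩ := hf
  obtain ⟨B, hB, hfB, hcB⟩ := hg
  refine ⟨A.bind B, hA.bind hB, fun x => ?_, ?_⟩
  · rw [Circuit.eval_bind, hfB, hfA]
  · rw [Circuit.cost_bind]
    push_cast
    linarith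

theorem precomp {ι' : Type} {f : (ι → K) → κ → K} {T : ℝ} (hf : Computes M f T) (r : ι → ι') :
    Computes M (fun x : ι' → K => f (x ∘ r)) T := by
  obtain ⟨A, hA, hfA, hcA⟩ := hf
  exact ⟨A.map r, hA.map r, fun x => by rw [Circuit.eval_map, hfA], by rwa [Circuit.cost_map]⟩

theorem comp {f : (ι → K) → κ → K} {g : (κ → K) → κ' → K} {S T : ℝ}
    (hg : Computes M g T) (hf : Computes M f S) :
    Computes M (fun x => g (f x)) (S + T) :=
  hf.bind (hg.precomp Sum.inl)

theorem postcomp {f : (ι → K) → κ → K} {T : ℝ} (hf : Computes M f T) (o : κ' → κ) :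
    Computes M (fun x k => f x (o k)) T := by
  simpa using (wire (M := M) o).comp hf

theorem sumElim {f : (ι → K) → κ → K} {g : (ι → K) → κ' → K} {S T : ℝ}
    (hf : Computes M f S) (hg : Computes M g T) :
    Computes M (fun x => Sum.elim (f x) (g x)) (S + T) := by
  have h := hf.bind ((hg.precomp (Sum.inr : ι → κ ⊕ ι)).bind
    (wire (M := M) (Sum.elim (fun k => Sum.inr (Sum.inl k)) Sum.inl)))
  rw [add_zero] at h
  convert h using 3 with x k
  cases k <;> rfl

/-- The inputs stay available after each circuit has run, so the circuits can be executed one after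
another without copying. -/
theorem family {J : Type} [Fintype J] {f : J → (ι → K) → κ → K} {T : J → ℝ}
    (h : ∀ j, Computes M (f j) (T j)) :
    Computes M (fun x (p : J × κ) => f p.1 x p.2) (∑ j, T j) := by
  classical
  have key : ∀ s : Finset J,
      Computes M (fun x (p : s × κ) => f p.1 x p.2) (∑ j ∈ s, T j) := by
    intro s
    induction s using Finset.induction_on with
    | empty =>
      exact ⟨.out fun p => absurd p.1.2 (Finset.notMem_empty _),
        Circuit.out_inModel _ M,
        fun x => funext fun p => absurd p.1.2 (Finset.notMem_empty _), by simp [Circuit.cost]⟩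
    | insert a s ha ih =>
      rw [Finset.sum_insert ha]
      have h' := ((h a).sumElim ih).postcomp
        (fun p : ↥(insert a s) × κ => if hp : (p.1 : J) = a then Sum.inl p.2
          else Sum.inr (⟨p.1, Finset.mem_of_mem_insert_of_ne p.1.2 hp⟩, p.2))
      convert h' using 3 with x p
      by_cases hp : (p.1 : J) = a
      · simp [hp]
      · simp [hp]
  exact (key Finset.univ).postcomp fun p : J × κ => (⟨p.1, Finset.mem_univ _⟩, p.2)

theorem of_apply [Fintype κ] {f : (ι → K) → κ → K} {T : κ → ℝ}
    (h : ∀ k, Computes M (fun x (_ : Unit) => f x k) (T k)) : Computes M f (∑ k, T k) :=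
  (family h).postcomp fun k => (k, ())

theorem gate (g : Gate K ι) (hg : g.IsLinear) {T : ℝ} (hT : (g.cost : ℝ) ≤ T) :
    Computes M (fun x (_ : Unit) => g.eval x) T := by
  refine ⟨.gate g (.out fun _ => none), Circuit.IsLinear.inModel ?_ M, fun _ => rfl, ?_⟩
  · simpa [Circuit.IsLinear] using hg
  · simpa [Circuit.cost] using hT

theorem add {f g : (ι → K) → K} {S T : ℝ} (hf : Computes M (fun x (_ : Unit) => f x) S)
    (hg : Computes M (fun x (_ : Unit) => g x) T) :
    Computes M (fun x (_ : Unit) => f x + g x) (S + T + 1) :=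
  (gate (M := M) (.add (Sum.inl ()) (Sum.inr ())) trivial (by simp [Gate.cost])).comp
    (hf.sumElim hg)

theorem sub {f g : (ι → K) → K} {S T : ℝ} (hf : Computes M (fun x (_ : Unit) => f x) S)
    (hg : Computes M (fun x (_ : Unit) => g x) T) :
    Computes M (fun x (_ : Unit) => f x - g x) (S + T + 1) :=
  (gate (M := M) (.sub (Sum.inl ()) (Sum.inr ())) trivial (by simp [Gate.cost])).comp
    (hf.sumElim hg)

theorem const_mul (a : K) {f : (ι → K) → K} {S : ℝ}
    (hf : Computes M (fun x (_ : Unit) => f x) S) :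
    Computes M (fun x (_ : Unit) => a * f x) (S + 1) :=
  (gate (M := M) (.smul a ()) trivial
    (by simp only [Gate.cost]; split_ifs <;> simp)).comp hf

theorem neg {f : (ι → K) → K} {S : ℝ} (hf : Computes M (fun x (_ : Unit) => f x) S) :
    Computes M (fun x (_ : Unit) => -f x) S := by
  have h := (gate (M := M) (.smul (-1 : K) ()) trivial (T := 0)
    (by simp [Gate.cost])).comp hf
  simpa [Gate.eval] using h

theorem proj (i : ι) : Computes M (fun (x : ι → K) (_ : Unit) => x i) 0 :=
  wire fun _ => i

end Computes

/-! ### Circuits on the real and imaginary parts of complex vectors -/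

/-- The complex vector with the given real and imaginary parts. -/
def ofParts {ι : Type} (v : ι ⊕ ι → ℝ) : ι → ℂ := fun i => ⟨v (Sum.inl i), v (Sum.inr i)⟩

/-- The real parts and the imaginary parts of a complex vector. -/
def toParts {ι : Type} (x : ι → ℂ) : ι ⊕ ι → ℝ := Sum.elim (fun i => (x i).re) fun i => (x i).im

theorem ofParts_toParts {ι : Type} (x : ι → ℂ) : ofParts (toParts x) = x := rfl

/-- Some circuit over `ℝ` of the model `M` computes the real and imaginary parts of the values of
`f` from those of the argument, with at most `T` operations. -/
def RealComputes (M : CircuitModel) {ι κ : Type} (f : (ι → ℂ) → κ → ℂ) (T : ℝ) : Prop :=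
  Computes M (fun v => toParts (f (ofParts v))) T

namespace RealComputes

variable {M : CircuitModel} {ι κ κ' : Type}

theorem mono {f : (ι → ℂ) → κ → ℂ} {S T : ℝ} (h : RealComputes M f S) (hST : S ≤ T) :
    RealComputes M f T :=
  Computes.mono h hST

theorem congr {f g : (ι → ℂ) → κ → ℂ} {T : ℝ} (hf : RealComputes M f T)
    (h : ∀ x k, g x k = f x k) : RealComputes M g T := by
  rwa [show g = f from funext fun x => funext fun k => h x k]

theorem comp {f : (ι → ℂ) → κ → ℂ} {g : (κ → ℂ) → κ' → ℂ} {S T : ℝ}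
    (hg : RealComputes M g T) (hf : RealComputes M f S) :
    RealComputes M (fun x => g (f x)) (S + T) :=
  Computes.comp hg hf

theorem precomp {ι' : Type} {f : (ι → ℂ) → κ → ℂ} {T : ℝ} (hf : RealComputes M f T)
    (r : ι → ι') : RealComputes M (fun x : ι' → ℂ => f (x ∘ r)) T :=
  Computes.precomp hf (Sum.map r r)

theorem postcomp {f : (ι → ℂ) → κ → ℂ} {T : ℝ} (hf : RealComputes M f T) (o : κ' → κ) :
    RealComputes M (fun x k => f x (o k)) T := by
  have h := Computes.postcomp hf (Sum.map o o)
  unfold RealComputes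
  convert h using 3 with x k
  cases k <;> rfl

theorem family {J : Type} [Fintype J] {f : J → (ι → ℂ) → κ → ℂ} {T : J → ℝ}
    (h : ∀ j, RealComputes M (f j) (T j)) :
    RealComputes M (fun x (p : J × κ) => f p.1 x p.2) (∑ j, T j) := by
  have h' := (Computes.family h).postcomp
    (Sum.elim (fun p => (p.1, Sum.inl p.2)) (fun p => (p.1, Sum.inr p.2)) :
      (J × κ) ⊕ (J × κ) → J × (κ ⊕ κ))
  unfold RealComputes
  convert h' using 3 with x k
  cases k <;> rfl

theorem of_apply [Fintype κ] {f : (ι → ℂ) → κ → ℂ} {T : κ → ℝ}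
    (h : ∀ k, RealComputes M (fun x (_ : Unit) => f x k) (T k)) : RealComputes M f (∑ k, T k) :=
  (family h).postcomp fun k => (k, ())

theorem sumElim {f : (ι → ℂ) → κ → ℂ} {g : (ι → ℂ) → κ' → ℂ} {S T : ℝ}
    (hf : RealComputes M f S) (hg : RealComputes M g T) :
    RealComputes M (fun x => Sum.elim (f x) (g x)) (S + T) := by
  have h := (Computes.sumElim hf hg).postcomp
    (Equiv.sumSumSumComm κ κ' κ κ')
  unfold RealComputes
  convert h using 3 with x k
  rcases k with (k | k) | (k | k) <;> rfl

/-- A real map, applied to the real parts and to the imaginary parts. -/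
theorem of_real {f : (ι → ℝ) → κ → ℝ} {T : ℝ} (hf : Computes M f T) :
    RealComputes M (fun x k => ⟨f (fun i => (x i).re) k, f (fun i => (x i).im) k⟩) (2 * T) := by
  have h := (hf.precomp (Sum.inl : ι → ι ⊕ ι)).sumElim (hf.precomp (Sum.inr : ι → ι ⊕ ι))
  rw [two_mul]
  exact h

theorem of_re_im {f : (ι → ℂ) → ℂ} {S T : ℝ}
    (hr : Computes M (fun v (_ : Unit) => (f (ofParts v)).re) S)
    (hi : Computes M (fun v (_ : Unit) => (f (ofParts v)).im) T) :
    RealComputes M (fun x (_ : Unit) => f x) (S + T) :=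
  hr.sumElim hi

theorem proj (i : ι) : RealComputes M (fun (x : ι → ℂ) (_ : Unit) => x i) 0 := by
  simpa using of_re_im (f := fun x => x i) (Computes.proj (M := M) (Sum.inl i))
    (Computes.proj (M := M) (Sum.inr i))

theorem lift₂ {f g : (ι → ℂ) → ℂ} {S T U : ℝ} {F : ℂ → ℂ → ℂ}
    (hf : RealComputes M (fun x (_ : Unit) => f x) S)
    (hg : RealComputes M (fun x (_ : Unit) => g x) T)
    (hF : RealComputes M (fun (x : Unit ⊕ Unit → ℂ) (_ : Unit) =>
      F (x (Sum.inl ())) (x (Sum.inr ()))) U) :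
    RealComputes M (fun x (_ : Unit) => F (f x) (g x)) (S + T + U) :=
  hF.comp (hf.sumElim hg)

theorem add {f g : (ι → ℂ) → ℂ} {S T : ℝ} (hf : RealComputes M (fun x (_ : Unit) => f x) S)
    (hg : RealComputes M (fun x (_ : Unit) => g x) T) :
    RealComputes M (fun x (_ : Unit) => f x + g x) (S + T + 2) := by
  refine lift₂ (F := fun a b => a + b) hf hg ((of_re_im
    ((Computes.proj (Sum.inl (Sum.inl ()))).add (Computes.proj (Sum.inl (Sum.inr ()))))
    ((Computes.proj (Sum.inr (Sum.inl ()))).add (Computes.proj (Sum.inr (Sum.inr ()))))).mono ?_)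
  norm_num

theorem sub {f g : (ι → ℂ) → ℂ} {S T : ℝ} (hf : RealComputes M (fun x (_ : Unit) => f x) S)
    (hg : RealComputes M (fun x (_ : Unit) => g x) T) :
    RealComputes M (fun x (_ : Unit) => f x - g x) (S + T + 2) := by
  refine lift₂ (F := fun a b => a - b) hf hg ((of_re_im
    ((Computes.proj (Sum.inl (Sum.inl ()))).sub (Computes.proj (Sum.inl (Sum.inr ()))))
    ((Computes.proj (Sum.inr (Sum.inl ()))).sub (Computes.proj (Sum.inr (Sum.inr ()))))).mono ?_)
  norm_num

theorem lift {f : (ι → ℂ) → ℂ} {S U : ℝ} {F : ℂ → ℂ}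
    (hf : RealComputes M (fun x (_ : Unit) => f x) S)
    (hF : RealComputes M (fun (x : Unit → ℂ) (_ : Unit) => F (x ())) U) :
    RealComputes M (fun x (_ : Unit) => F (f x)) (S + U) :=
  hF.comp hf

theorem ofReal_mul (a : ℝ) {f : (ι → ℂ) → ℂ} {S : ℝ}
    (hf : RealComputes M (fun x (_ : Unit) => f x) S) :
    RealComputes M (fun x (_ : Unit) => (a : ℂ) * f x) (S + 2) := by
  refine lift (F := fun z => (a : ℂ) * z) hf ((of_re_im (S := 0 + 1) (T := 0 + 1) ?_ ?_).mono ?_)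
  · simpa [ofParts] using (Computes.proj (M := M) (Sum.inl ())).const_mul a
  · simpa [ofParts] using (Computes.proj (M := M) (Sum.inr ())).const_mul a
  · norm_num

/-- Free: the parts are exchanged, and one sign is changed by the scalar `-1`. -/
theorem I_mul {f : (ι → ℂ) → ℂ} {S : ℝ} (hf : RealComputes M (fun x (_ : Unit) => f x) S) :
    RealComputes M (fun x (_ : Unit) => Complex.I * f x) S := by
  refine (lift (F := fun z => Complex.I * z) hf (of_re_im (S := 0) (T := 0) ?_ ?_)).mono ?_
  · simpa [ofParts] using (Computes.proj (M := M) (K := ℝ) (Sum.inr ())).neg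
  · simpa [ofParts] using (Computes.proj (M := M) (Sum.inl ()))
  · simp

end RealComputes

/-! ### The Walsh-Hadamard transform -/

theorem walshHadamard_succ_mulVec {K : Type} [Field K] (k : ℕ) (x : Fin (2 ^ (k + 1)) → K) :
    (walshHadamard K (k + 1)).mulVec x =
      Sum.elim
        ((walshHadamard K k).mulVec (x ∘ halves k ∘ Sum.inl) +
          (walshHadamard K k).mulVec (x ∘ halves k ∘ Sum.inr))
        ((walshHadamard K k).mulVec (x ∘ halves k ∘ Sum.inl) -
          (walshHadamard K k).mulVec (x ∘ halves k ∘ Sum.inr)) ∘ (halves k).symm := by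
  rw [walshHadamard, Matrix.reindex_apply, Matrix.submatrix_mulVec_equiv, Equiv.symm_symm,
    Matrix.fromBlocks_mulVec, Matrix.neg_mulVec, sub_eq_add_neg]
  rfl

/-- Each of the `k` levels spends one addition or subtraction per output. -/
theorem computes_walshHadamard (M : CircuitModel) (k : ℕ) :
    Computes M (fun x : Fin (2 ^ k) → ℝ => (walshHadamard ℝ k).mulVec x) (2 ^ k * k) := by
  induction k with
  | zero =>
    have h := Computes.wire (M := M) (K := ℝ) (id : Fin (2 ^ 0) → Fin (2 ^ 0))
    simpa [walshHadamard] using h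
  | succ k ih =>
    have h1 := (ih.precomp (halves k ∘ Sum.inl)).sumElim (ih.precomp (halves k ∘ Sum.inr))
    have h2 : Computes M
        (fun (y : Fin (2 ^ k) ⊕ Fin (2 ^ k) → ℝ) (s : Fin (2 ^ k) ⊕ Fin (2 ^ k)) =>
          Sum.elim (fun a => y (Sum.inl a) + y (Sum.inr a))
            (fun a => y (Sum.inl a) - y (Sum.inr a)) s)
        (∑ _s : Fin (2 ^ k) ⊕ Fin (2 ^ k), (0 + 0 + 1)) := by
      refine Computes.of_apply ?_
      rintro (a | a)
      · exact (Computes.proj _).add (Computes.proj _)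
      · exact (Computes.proj _).sub (Computes.proj _)
    have h3 := ((h2.comp h1).postcomp (halves k).symm).mono (T := 2 ^ (k + 1) * ((k + 1 : ℕ) : ℝ))
      (by simp; ring_nf; rfl)
    convert h3 using 2 with x
    rw [walshHadamard_succ_mulVec]
    funext s
    rcases h : (halves k).symm s with a | a <;> simp [h]

theorem whtComputable_one (M : CircuitModel) : WHTComputable M ℝ 1 := by
  refine ⟨0, fun k => ?_⟩
  obtain ⟨A, hA, hf, hc⟩ := computes_walshHadamard M k
  exact ⟨A, hA, hf, by simpa using hc⟩

/-- A negative leading coefficient would make the cost negative for large `k`. The sign is needed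
where the leaf with two points is bounded by the general formula. -/
theorem WHTComputable.nonneg {M : CircuitModel} {K : Type} [Field K] {c : ℝ}
    (h : WHTComputable M K c) : 0 ≤ c := by
  obtain ⟨C, h⟩ := h
  by_contra! hc
  obtain ⟨k, hk⟩ := exists_nat_gt (C / -c)
  obtain ⟨A, -, -, hA⟩ := h k
  rw [div_lt_iff₀ (by linarith)] at hk
  have h1 : (0 : ℝ) ≤ 2 ^ k * (c * k + C) := by
    have : (0 : ℝ) ≤ A.cost := Nat.cast_nonneg _
    linarith
  have h2 : (0 : ℝ) ≤ c * k + C := nonneg_of_mul_nonneg_right h1 (by positivity)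
  linarith

/-! ### The index set of the split-radix recursion -/

/-- The inputs of a transform of length `2 ^ n`, split recursively into the even ones and the two
odd classes modulo four. -/
def SplitIndex : ℕ → Type
  | 0 => Unit
  | 1 => Bool
  | n + 2 => SplitIndex (n + 1) ⊕ (SplitIndex n ⊕ SplitIndex n)

instance SplitIndex.instFintype : (n : ℕ) → Fintype (SplitIndex n)
  | 0 => inferInstanceAs (Fintype Unit)
  | 1 => inferInstanceAs (Fintype Bool)
  | n + 2 =>
    letI := SplitIndex.instFintype (n + 1)
    letI := SplitIndex.instFintype n
    inferInstanceAs (Fintype (SplitIndex (n + 1) ⊕ (SplitIndex n ⊕ SplitIndex n)))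

theorem SplitIndex.sum_add_two {V : Type*} [AddCommMonoid V] {n : ℕ}
    (f : SplitIndex (n + 2) → V) :
    ∑ j, f j = ∑ j : SplitIndex (n + 1), f (Sum.inl j) +
      (∑ j : SplitIndex n, f (Sum.inr (Sum.inl j)) +
        ∑ j : SplitIndex n, f (Sum.inr (Sum.inr j))) :=
  (Fintype.sum_sum_type (α₁ := SplitIndex (n + 1)) (α₂ := SplitIndex n ⊕ SplitIndex n) f).trans
    (congrArg _ (Fintype.sum_sum_type _))

theorem SplitIndex.card : (n : ℕ) → Fintype.card (SplitIndex n) = 2 ^ n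
  | 0 => rfl
  | 1 => rfl
  | n + 2 => by
    rw [Fintype.card_eq_sum_ones, SplitIndex.sum_add_two]
    simp only [← Fintype.card_eq_sum_ones, SplitIndex.card (n + 1), SplitIndex.card n]
    ring

/-! ### The butterflies on the inputs -/

/-- Recursively replace the two odd classes of inputs by their sum and difference. -/
def splitButterfly {V : Type} [AddCommGroup V] : (n : ℕ) → (SplitIndex n → V) → SplitIndex n → V
  | 0, y => y
  | 1, y => y
  | n + 2, y =>
    Sum.elim (splitButterfly (n + 1) fun j => y (Sum.inl j))
      (Sum.elim
        (splitButterfly n fun j => y (Sum.inr (Sum.inl j)) + y (Sum.inr (Sum.inr j)))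
        (splitButterfly n fun j => y (Sum.inr (Sum.inl j)) - y (Sum.inr (Sum.inr j))))

theorem map_splitButterfly {V W : Type} [AddCommGroup V] [AddCommGroup W] (φ : V →+ W) :
    (n : ℕ) → (y : SplitIndex n → V) → (j : SplitIndex n) →
      φ (splitButterfly n y j) = splitButterfly n (fun i => φ (y i)) j
  | 0, _, _ => rfl
  | 1, _, _ => rfl
  | n + 2, y, j => by
    rcases j with j | j | j
    · exact map_splitButterfly φ (n + 1) _ j
    · refine (map_splitButterfly φ n _ j).trans ?_
      simp only [map_add]
      rfl
    · refine (map_splitButterfly φ n _ j).trans ?_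
      simp only [map_sub]
      rfl

/-- Naturality applied to the addition homomorphism `V × V → V`. -/
theorem splitButterfly_add {V : Type} [AddCommGroup V] (n : ℕ) (y z : SplitIndex n → V)
    (j : SplitIndex n) :
    splitButterfly n (fun i => y i + z i) j = splitButterfly n y j + splitButterfly n z j := by
  have h := map_splitButterfly (AddMonoidHom.fst V V + AddMonoidHom.snd V V) n
    (fun i => (y i, z i)) j
  have h1 := map_splitButterfly (AddMonoidHom.fst V V) n (fun i => (y i, z i)) j
  have h2 := map_splitButterfly (AddMonoidHom.snd V V) n (fun i => (y i, z i)) j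
  simp only [AddMonoidHom.add_apply, h1, h2] at h
  exact h.symm

theorem splitButterfly_sub {V : Type} [AddCommGroup V] (n : ℕ) (y z : SplitIndex n → V)
    (j : SplitIndex n) :
    splitButterfly n (fun i => y i - z i) j = splitButterfly n y j - splitButterfly n z j := by
  have h := splitButterfly_add n y (fun i => -z i) j
  have h' := map_splitButterfly (-AddMonoidHom.id V) n z j
  simp only [AddMonoidHom.neg_apply, AddMonoidHom.id_apply] at h'
  simpa only [sub_eq_add_neg, h'] using h

/-- The Kronecker product of the Walsh-Hadamard transform and the input butterflies is, up to a
permutation, a direct sum of Walsh-Hadamard transforms. -/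
theorem computes_walshHadamard_splitButterfly {M : CircuitModel} {c C : ℝ} (hc : 0 ≤ c)
    (h : ∀ m : ℕ, Computes M (fun x : Fin (2 ^ m) → ℝ => (walshHadamard ℝ m).mulVec x)
      (c * 2 ^ m * m + C * 2 ^ m)) :
    (n m : ℕ) → Computes M
      (fun (x : Fin (2 ^ m) × SplitIndex n → ℝ) (p : Fin (2 ^ m) × SplitIndex n) =>
        (walshHadamard ℝ m).mulVec (fun b => splitButterfly n (fun j => x (b, j)) p.2) p.1)
      (2 ^ (m + n) * (c * (m + n / 3) + C))
  | 0, m => by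
    refine (((h m).precomp fun b => (b, ())).postcomp
      fun p : Fin (2 ^ m) × SplitIndex 0 => p.1).mono (le_of_eq ?_)
    simp
    ring
  | 1, m => by
    have h' := Computes.family fun b : Bool => (h m).precomp fun a => (a, b)
    refine (h'.postcomp fun p : Fin (2 ^ m) × SplitIndex 1 => (p.2, p.1)).mono ?_
    -- Two transforms of size `2 ^ m` are needed; the term `n / 3` of the bound is slack here,
    -- nonnegative because `c` is.
    have : 0 ≤ c * 2 ^ m := by positivity
    simp [pow_succ]
    linarith
  | n + 2, m => by
    have h1 := (computes_walshHadamard_splitButterfly hc h (n + 1) m).precomp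
      fun p => ((p.1, Sum.inl p.2) : Fin (2 ^ m) × SplitIndex (n + 2))
    -- The sum and difference of the odd classes form a factor `H_2`, absorbed into the next larger
    -- Walsh-Hadamard matrix. Both summands have `2 ^ (m + n + 1)` points, so `m + n / 3` is
    -- reproduced as an average.
    have h2 := (computes_walshHadamard_splitButterfly hc h n (m + 1)).precomp
      fun p => (((halves m).symm p.1).elim (fun b => (b, Sum.inr (Sum.inl p.2)))
        (fun b => (b, Sum.inr (Sum.inr p.2))) : Fin (2 ^ m) × SplitIndex (n + 2))
    have h3 := (h1.sumElim h2).postcomp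
      (fun p : Fin (2 ^ m) × SplitIndex (n + 2) => (match p with
        | (a, Sum.inl j) => Sum.inl (a, j)
        | (a, Sum.inr (Sum.inl j)) => Sum.inr (halves m (Sum.inl a), j)
        | (a, Sum.inr (Sum.inr j)) => Sum.inr (halves m (Sum.inr a), j) :
        (Fin (2 ^ m) × SplitIndex (n + 1)) ⊕ (Fin (2 ^ (m + 1)) × SplitIndex n)))
    have h4 := h3.mono (T := 2 ^ (m + (n + 2)) * (c * (m + ((n + 2 : ℕ) : ℝ) / 3) + C))
      (le_of_eq (by push_cast; ring))
    convert h4 using 3 with x p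
    obtain ⟨a, j | j | j⟩ := p
    · rfl
    · simp only [Sum.elim_inr, walshHadamard_succ_mulVec, splitButterfly, Sum.elim_inl,
        splitButterfly_add, Function.comp_apply, Equiv.symm_apply_apply, Pi.add_apply]
      rw [← Pi.add_apply, ← Matrix.mulVec_add]
      simp only [Function.comp_def, Equiv.symm_apply_apply, Sum.elim_inl, Sum.elim_inr]
      rfl
    · simp only [Sum.elim_inr, walshHadamard_succ_mulVec, splitButterfly,
        splitButterfly_sub, Function.comp_apply, Equiv.symm_apply_apply, Pi.sub_apply]
      rw [← Pi.sub_apply, ← Matrix.mulVec_sub]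
      simp only [Function.comp_def, Equiv.symm_apply_apply, Sum.elim_inl, Sum.elim_inr]
      rfl

theorem realComputes_splitButterfly {M : CircuitModel} {c C : ℝ} (hc : 0 ≤ c)
    (h : ∀ m : ℕ, Computes M (fun x : Fin (2 ^ m) → ℝ => (walshHadamard ℝ m).mulVec x)
      (c * 2 ^ m * m + C * 2 ^ m)) (n : ℕ) :
    RealComputes M (fun y : SplitIndex n → ℂ => splitButterfly n y)
      (2 ^ n * (2 / 3 * c * n + 2 * C)) := by
  have h1 := RealComputes.of_real (((computes_walshHadamard_splitButterfly hc h n 0).precomp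
    Prod.snd).postcomp (fun j => ((0 : Fin (2 ^ 0)), j)))
  have h2 := h1.mono (T := 2 ^ n * (2 / 3 * c * n + 2 * C)) (le_of_eq (by simp; ring))
  convert h2 using 3 with y j
  apply Complex.ext
  · simpa [walshHadamard] using map_splitButterfly Complex.reAddGroupHom n y j
  · simpa [walshHadamard] using map_splitButterfly Complex.imAddGroupHom n y j

/-! ### The transform after the input butterflies -/

/-- The angle `2 π k / 2 ^ n`. -/
noncomputable def dyadicAngle (n k : ℕ) : ℝ := 2 * Real.pi * k / 2 ^ n

theorem dyadicAngle_add_quarter (n k : ℕ) :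
    dyadicAngle (n + 2) (k + 2 ^ n) = dyadicAngle (n + 2) k + Real.pi / 2 := by
  unfold dyadicAngle
  push_cast
  rw [pow_add]
  field_simp

/-- The split-radix recursion for the transform of length `2 ^ n`, with conjugate twiddle factors,
in terms of the sums and differences of the two odd classes of inputs. -/
noncomputable def splitFourier : (n : ℕ) → (SplitIndex n → ℂ) → ℕ → ℂ
  | 0, w, _ => w ()
  | 1, w, k => w false + (-1) ^ k * w true
  | n + 2, w, k =>
    splitFourier (n + 1) (fun j => w (Sum.inl j)) k +
      (Real.cos (dyadicAngle (n + 2) k) * splitFourier n (fun j => w (Sum.inr (Sum.inl j))) k -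
        Complex.I * (Real.sin (dyadicAngle (n + 2) k) *
          splitFourier n (fun j => w (Sum.inr (Sum.inr j))) k))

/-- A full period is four quarter turns for the twiddle factors, four periods of the transforms of
the odd classes and two periods of the even half. -/
theorem splitFourier_add_period : (n : ℕ) → (w : SplitIndex n → ℂ) → (k : ℕ) →
    splitFourier n w (k + 2 ^ n) = splitFourier n w k
  | 0, _, _ => rfl
  | 1, w, k => by simp [splitFourier, pow_succ]
  | n + 2, w, k => by
    have h1 (w) (l : ℕ) : splitFourier (n + 1) w (l + (2 ^ n + 2 ^ n)) =
        splitFourier (n + 1) w l := by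
      rw [← splitFourier_add_period (n + 1) w l, pow_succ, mul_two]
    have hk : k + 2 ^ (n + 2) = k + 2 ^ n + 2 ^ n + 2 ^ n + 2 ^ n := by ring
    have e1 : k + 2 ^ n + 2 ^ n + 2 ^ n + 2 ^ n = k + (2 ^ n + 2 ^ n) + (2 ^ n + 2 ^ n) := by ring
    rw [hk]
    simp only [splitFourier, splitFourier_add_period n, dyadicAngle_add_quarter,
      Real.cos_add_pi_div_two, Real.sin_add_pi_div_two]
    rw [e1, h1, h1]
    simp

/-- The scaling of the outputs which makes one part of every twiddle factor equal to one. -/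
noncomputable def twiddleScale : ℕ → ℕ → ℝ
  | 0, _ => 1
  | 1, _ => 1
  | n + 2, k => twiddleScale n (k % 2 ^ n) * Real.cos (dyadicAngle (n + 2) (k % 2 ^ n))

/-- The angle lies in the first quadrant. This is why the scale reduces its index modulo a quarter
of the length, which keeps it invertible. -/
theorem cos_dyadicAngle_pos {n k : ℕ} (hk : k < 2 ^ n) :
    0 < Real.cos (dyadicAngle (n + 2) k) := by
  have h0 : 0 ≤ dyadicAngle (n + 2) k := by
    unfold dyadicAngle
    positivity
  have h1 : dyadicAngle (n + 2) k < Real.pi / 2 := by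
    have hk' : (k : ℝ) < 2 ^ n := by exact_mod_cast hk
    have := Real.pi_pos
    unfold dyadicAngle
    rw [pow_add, div_lt_div_iff₀ (by positivity) (by norm_num)]
    nlinarith
  exact Real.cos_pos_of_mem_Ioo ⟨by linarith [Real.pi_pos], h1⟩

theorem twiddleScale_ne_zero : (n k : ℕ) → twiddleScale n k ≠ 0
  | 0, _ => one_ne_zero
  | 1, _ => one_ne_zero
  | n + 2, _ => mul_ne_zero (twiddleScale_ne_zero n _)
      (cos_dyadicAngle_pos (Nat.mod_lt _ (by positivity))).ne'

theorem twiddleScale_add_period (n k : ℕ) :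
    twiddleScale (n + 2) (k + 2 ^ n) = twiddleScale (n + 2) k := by
  simp [twiddleScale]

theorem twiddleScale_add_two {n k : ℕ} (hk : k < 2 ^ n) :
    twiddleScale (n + 2) k = twiddleScale n k * Real.cos (dyadicAngle (n + 2) k) := by
  rw [twiddleScale, Nat.mod_eq_of_lt hk]

/-- The combination step of the split-radix recursion, on two outputs `u₀, u₁` of the even half and
the outputs `p, q` for the sum and the difference of the odd classes. -/
noncomputable def splitStep (t a b : ℝ) (x : Fin 4 → ℂ) : Fin 4 → ℂ :=
  ![x 0 + a * (x 2 - Complex.I * (t * x 3)), x 1 - Complex.I * (b * (x 3 - Complex.I * (t * x 2))),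
    x 0 - a * (x 2 - Complex.I * (t * x 3)), x 1 + Complex.I * (b * (x 3 - Complex.I * (t * x 2)))]

/-! ### Cost and correctness of one combination step -/

section

variable {M : CircuitModel}

theorem realComputes_twiddle (t : ℝ) :
    RealComputes M (fun x : Fin 4 → ℂ => ![x 0, x 1, x 2 - Complex.I * (t * x 3),
      x 3 - Complex.I * (t * x 2)]) 8 := by
  refine (RealComputes.of_apply (T := ![0, 0, 4, 4]) fun k => ?_).mono ?_
  · fin_cases k
    · exact RealComputes.proj 0
    · exact RealComputes.proj 1
    · exact ((RealComputes.proj 2).sub ((RealComputes.proj 3).ofReal_mul t).I_mul).mono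
        (by norm_num)
    · exact ((RealComputes.proj 3).sub ((RealComputes.proj 2).ofReal_mul t).I_mul).mono
        (by norm_num)
  · simp only [Fin.sum_univ_four, Matrix.cons_val]
    norm_num

theorem realComputes_scale_pair (a b : ℝ) :
    RealComputes M (fun x : Fin 4 → ℂ => ![x 0, x 1, a * x 2, b * x 3]) 4 := by
  refine (RealComputes.of_apply (T := ![0, 0, 2, 2]) fun k => ?_).mono ?_
  · fin_cases k
    · exact RealComputes.proj 0
    · exact RealComputes.proj 1
    · exact ((RealComputes.proj 2).ofReal_mul a).mono (by norm_num)
    · exact ((RealComputes.proj 3).ofReal_mul b).mono (by norm_num)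
  · simp only [Fin.sum_univ_four, Matrix.cons_val]
    norm_num

theorem realComputes_output_butterfly :
    RealComputes M (fun x : Fin 4 → ℂ => ![x 0 + x 2, x 1 - Complex.I * x 3, x 0 - x 2,
      x 1 + Complex.I * x 3]) 8 := by
  refine (RealComputes.of_apply (T := ![2, 2, 2, 2]) fun k => ?_).mono ?_
  · fin_cases k
    · exact ((RealComputes.proj 0).add (RealComputes.proj 2)).mono (by norm_num)
    · exact ((RealComputes.proj 1).sub (RealComputes.proj 3).I_mul).mono (by norm_num)
    · exact ((RealComputes.proj 0).sub (RealComputes.proj 2)).mono (by norm_num)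
    · exact ((RealComputes.proj 1).add (RealComputes.proj 3).I_mul).mono (by norm_num)
  · simp only [Fin.sum_univ_four, Matrix.cons_val]
    norm_num

theorem realComputes_splitStep (t a b : ℝ) : RealComputes M (splitStep t a b) 20 := by
  refine RealComputes.mono (S := 8 + 4 + 8) ?_ (by norm_num)
  exact realComputes_output_butterfly.comp
    ((realComputes_scale_pair a b).comp (realComputes_twiddle t))

/-- When both ratios are one, the four real multiplications of the scaling layer disappear. -/
theorem realComputes_splitStep_one (t : ℝ) : RealComputes M (splitStep t 1 1) 16 := by
  have h := (realComputes_output_butterfly (M := M)).comp (realComputes_twiddle t)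
  refine RealComputes.mono (S := 8 + 8) ?_ (by norm_num)
  convert h using 3 with x k
  simp [splitStep]

theorem realComputes_scale {ι κ : Type} [Fintype κ] {f : (ι → ℂ) → κ → ℂ} {T : ℝ}
    (hf : RealComputes M f T) (r : κ → ℝ) :
    RealComputes M (fun x k => (r k : ℂ) * f x k) (T + 2 * Fintype.card κ) := by
  have h : RealComputes M (fun (x : κ → ℂ) k => (r k : ℂ) * x k) (∑ _k : κ, (0 + 2)) :=
    RealComputes.of_apply fun k => (RealComputes.proj k).ofReal_mul (r k)
  refine (h.comp hf).mono (le_of_eq ?_)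
  simp [mul_comm]

/-- The outputs of a transform of length `2 ^ n`, scaled by the factors for length `2 ^ (n + d)`. -/
noncomputable def scaledFourier (n d : ℕ) (w : SplitIndex n → ℂ) (k : ℕ) : ℂ :=
  ((twiddleScale (n + d) k)⁻¹ : ℝ) * splitFourier n w k

/-- One level of the recursion, where the outputs are scaled for length `2 ^ (n + 2 + d)` with
`d ≤ 1`. -/
theorem scaledFourier_add_two {n d : ℕ} (hd : d ≤ 1) (w : SplitIndex (n + 2) → ℂ) {k : ℕ}
    (hk : k < 2 ^ n) (i : Fin 4) :
    scaledFourier (n + 2) d w (k + i * 2 ^ n) =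
      splitStep (Real.tan (dyadicAngle (n + 2) k))
        (twiddleScale (n + 2) k / twiddleScale (n + 2 + d) k)
        (twiddleScale (n + 2) k / twiddleScale (n + 2 + d) (k + 2 ^ n))
        ![scaledFourier (n + 1) (d + 1) (fun j => w (Sum.inl j)) k,
          scaledFourier (n + 1) (d + 1) (fun j => w (Sum.inl j)) (k + 2 ^ n),
          scaledFourier n 0 (fun j => w (Sum.inr (Sum.inl j))) k,
          scaledFourier n 0 (fun j => w (Sum.inr (Sum.inr j))) k] i := by
  -- For `d = 0` the scale has period `2 ^ n`, for `d = 1` period `2 ^ (n + 1)`; larger `d` would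
  -- not fit two half-period shifts.
  have hper (l : ℕ) : twiddleScale (n + 2 + d) (l + 2 ^ n + 2 ^ n) =
      twiddleScale (n + 2 + d) l := by
    interval_cases d
    · rw [add_zero, twiddleScale_add_period, twiddleScale_add_period]
    · rw [add_assoc l, ← mul_two, ← pow_succ]
      exact twiddleScale_add_period (n + 1) l
  have hU (v) (l : ℕ) : splitFourier (n + 1) v (l + 2 ^ n + 2 ^ n) = splitFourier (n + 1) v l := by
    rw [add_assoc l, ← mul_two, ← pow_succ]
    exact splitFourier_add_period (n + 1) v l
  have hidx : n + 1 + (d + 1) = n + 2 + d := by ring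
  have hs := twiddleScale_ne_zero n k
  have hc := (cos_dyadicAngle_pos hk).ne'
  have hs0 : ((twiddleScale (n + 2 + d) k : ℝ) : ℂ) ≠ 0 := by
    exact_mod_cast twiddleScale_ne_zero _ _
  have hs1 : ((twiddleScale (n + 2 + d) (k + 2 ^ n) : ℝ) : ℂ) ≠ 0 := by
    exact_mod_cast twiddleScale_ne_zero _ _
  have hsC : ((twiddleScale n k : ℝ) : ℂ) ≠ 0 := by exact_mod_cast hs
  have hcC : ((Real.cos (dyadicAngle (n + 2) k) : ℝ) : ℂ) ≠ 0 := by exact_mod_cast hc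
  have e0 : k + ((0 : Fin 4) : ℕ) * 2 ^ n = k := by simp
  have e1 : k + ((1 : Fin 4) : ℕ) * 2 ^ n = k + 2 ^ n := by simp
  have e2 : k + ((2 : Fin 4) : ℕ) * 2 ^ n = k + 2 ^ n + 2 ^ n := by
    change k + 2 * 2 ^ n = _
    ring
  have e3 : k + ((3 : Fin 4) : ℕ) * 2 ^ n = k + 2 ^ n + 2 ^ n + 2 ^ n := by
    change k + 3 * 2 ^ n = _
    ring
  have hi : i = 0 ∨ i = 1 ∨ i = 2 ∨ i = 3 := by
    fin_cases i <;> simp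
  rcases hi with rfl | rfl | rfl | rfl
  · rw [e0]
    simp only [scaledFourier, splitFourier, splitStep, hidx, twiddleScale_add_two hk,
      Real.tan_eq_sin_div_cos, add_zero, Matrix.cons_val]
    push_cast
    push_cast at hcC
    field_simp
  · rw [e1]
    simp only [scaledFourier, splitFourier, splitStep, hidx, twiddleScale_add_two hk,
      Real.tan_eq_sin_div_cos, add_zero, Matrix.cons_val, dyadicAngle_add_quarter,
      Real.cos_add_pi_div_two, Real.sin_add_pi_div_two, splitFourier_add_period n]
    push_cast
    push_cast at hcC
    field_simp
    -- At a quarter turn the cosine becomes minus the sine; `splitStep` writes this sign as a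
    -- product of two factors `-i`.
    linear_combination -Complex.sin (dyadicAngle (n + 2) k) *
      splitFourier n (fun j => w (Sum.inr (Sum.inl j))) k * Complex.I_sq
  · rw [e2]
    simp only [scaledFourier, splitFourier, splitStep, hidx, twiddleScale_add_two hk,
      Real.tan_eq_sin_div_cos, add_zero, Matrix.cons_val, dyadicAngle_add_quarter,
      Real.cos_add_pi_div_two, Real.sin_add_pi_div_two, splitFourier_add_period n, hU, hper]
    push_cast
    push_cast at hcC
    field_simp
    ring
  · rw [e3]
    simp only [scaledFourier, splitFourier, splitStep, hidx, twiddleScale_add_two hk,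
      Real.tan_eq_sin_div_cos, add_zero, Matrix.cons_val, dyadicAngle_add_quarter,
      Real.cos_add_pi_div_two, Real.sin_add_pi_div_two, splitFourier_add_period n, hU, hper]
    push_cast
    push_cast at hcC
    field_simp
    linear_combination Complex.sin (dyadicAngle (n + 2) k) *
      splitFourier n (fun j => w (Sum.inr (Sum.inl j))) k * Complex.I_sq

end

/-! ### The cost of the scaled transform -/

/-- Outputs are grouped by their residue modulo a quarter of the length. Each group of four is one
combination step, using two outputs of the even half and one from each odd part. The even half is
one level shorter but keeps the same target scale, hence `d + 1`. -/
theorem realComputes_scaledFourier_add_two {M : CircuitModel} {n d : ℕ} (hd : d ≤ 1) {U S T : ℝ}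
    (hU : RealComputes M
      (fun w (k : Fin (2 ^ (n + 1))) => scaledFourier (n + 1) (d + 1) w k) U)
    (hS : RealComputes M (fun w (k : Fin (2 ^ n)) => scaledFourier n 0 w k) S)
    (hT : ∀ k < 2 ^ n, RealComputes M (splitStep (Real.tan (dyadicAngle (n + 2) k))
        (twiddleScale (n + 2) k / twiddleScale (n + 2 + d) k)
        (twiddleScale (n + 2) k / twiddleScale (n + 2 + d) (k + 2 ^ n))) T) :
    RealComputes M (fun w (k : Fin (2 ^ (n + 2))) => scaledFourier (n + 2) d w k)
      (U + 2 * S + 2 ^ n * T) := by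
  have h1 := (hU.precomp (Sum.inl : _ → SplitIndex (n + 2))).sumElim
    ((hS.precomp (fun j => (Sum.inr (Sum.inl j) : SplitIndex (n + 2)))).sumElim
      (hS.precomp (fun j => (Sum.inr (Sum.inr j) : SplitIndex (n + 2)))))
  have hlt (k : Fin (2 ^ n)) : (k : ℕ) + 2 ^ n < 2 ^ (n + 1) := by
    have := k.2
    rw [pow_succ]
    lia
  have hdiv (k : Fin (2 ^ (n + 2))) : (k : ℕ) / 2 ^ n < 4 :=
    Nat.div_lt_of_lt_mul (lt_of_lt_of_eq k.2 (pow_add 2 n 2))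
  have h2 := RealComputes.family fun k : Fin (2 ^ n) => (hT k k.2).precomp
    (![Sum.inl ⟨k, by have := hlt k; lia⟩, Sum.inl ⟨k + 2 ^ n, hlt k⟩,
      Sum.inr (Sum.inl k), Sum.inr (Sum.inr k)] :
      Fin 4 → Fin (2 ^ (n + 1)) ⊕ (Fin (2 ^ n) ⊕ Fin (2 ^ n)))
  have h3 := (h2.comp h1).postcomp fun k : Fin (2 ^ (n + 2)) =>
    ((⟨k % 2 ^ n, Nat.mod_lt _ (by positivity)⟩ : Fin (2 ^ n)),
      (⟨k / 2 ^ n, hdiv k⟩ : Fin 4))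
  refine (h3.mono (T := U + 2 * S + 2 ^ n * T) (le_of_eq (by simp; ring))).congr fun w k => ?_
  conv_lhs => rw [← Nat.mod_add_div' (k : ℕ) (2 ^ n)]
  rw [scaledFourier_add_two hd w (Nat.mod_lt _ (by positivity))
    (⟨k / 2 ^ n, hdiv k⟩ : Fin 4)]
  congr 1
  funext i
  fin_cases i <;> rfl

theorem realComputes_scaledFourier_rescale {M : CircuitModel} {n : ℕ} {T : ℝ}
    (h : RealComputes M (fun w (k : Fin (2 ^ n)) => scaledFourier n 0 w k) T) (d : ℕ) :
    RealComputes M (fun w (k : Fin (2 ^ n)) => scaledFourier n d w k) (T + 2 * 2 ^ n) := by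
  have h' := realComputes_scale h fun k => twiddleScale n k / twiddleScale (n + d) k
  rw [Fintype.card_fin] at h'
  push_cast at h'
  convert h' using 3 with w k
  have h0 : ((twiddleScale n k : ℝ) : ℂ) ≠ 0 := by exact_mod_cast twiddleScale_ne_zero _ _
  simp only [scaledFourier, add_zero]
  push_cast
  field_simp

/-- Let `a n` and `b n` be the bounds per point for `d = 0` and `d = 1`. The recursions are `a (n+2)
= b (n+1) / 2 + a n / 2 + 4` and `b (n+2) = a (n+1) / 2 + a n / 2 + 6`. For a linear solution with
common slope they force slope `28/9` and gap `b - a = 4/3`. The additive constant is otherwise free,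
and `2` is ample for `n = 0, 1`. -/
theorem realComputes_scaledFourier (M : CircuitModel) : (n : ℕ) →
    RealComputes M (fun w (k : Fin (2 ^ n)) => scaledFourier n 0 w k)
      (2 ^ n * (28 / 9 * n + 2)) ∧
    RealComputes M (fun w (k : Fin (2 ^ n)) => scaledFourier n 1 w k)
      (2 ^ n * (28 / 9 * n + 10 / 3))
  | 0 => by
    have h (d : ℕ) (hd : d ≤ 1) :
        RealComputes M (fun w (k : Fin (2 ^ 0)) => scaledFourier 0 d w k) 0 := by
      have := (RealComputes.proj (M := M) (() : SplitIndex 0)).postcomp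
        fun _ : Fin (2 ^ 0) => ()
      refine this.congr fun w k => ?_
      interval_cases d <;> simp [scaledFourier, twiddleScale, splitFourier]
    exact ⟨(h 0 (by simp)).mono (by norm_num), (h 1 (by simp)).mono (by norm_num)⟩
  | 1 => by
    have h (d : ℕ) (hd : d ≤ 1) :
        RealComputes M (fun w (k : Fin (2 ^ 1)) => scaledFourier 1 d w k) 4 := by
      refine (RealComputes.of_apply (T := fun _ => 2) fun k => ?_).mono (by norm_num)
      have hs : twiddleScale (1 + d) k = 1 := by
        interval_cases d <;> simp [twiddleScale, dyadicAngle, Nat.mod_one]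
      simp only [scaledFourier, hs, splitFourier]
      fin_cases k
      · exact (((RealComputes.proj (ι := SplitIndex 1) false).add
          (RealComputes.proj true)).mono (by norm_num)).congr fun w _ => by simp
      · exact (((RealComputes.proj (ι := SplitIndex 1) false).sub
          (RealComputes.proj true)).mono (by norm_num)).congr
            fun w _ => by simp [sub_eq_add_neg]
    exact ⟨(h 0 (by simp)).mono (by norm_num), (h 1 (by simp)).mono (by norm_num)⟩
  | n + 2 => by
    obtain ⟨hn, -⟩ := realComputes_scaledFourier M n
    obtain ⟨hn0, hn1⟩ := realComputes_scaledFourier M (n + 1)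
    constructor
    · refine (realComputes_scaledFourier_add_two (d := 0) (by simp) hn1 hn (T := 16)
        fun k _ => ?_).mono (le_of_eq (by push_cast; ring))
      rw [add_zero, twiddleScale_add_period, div_self (twiddleScale_ne_zero _ _)]
      exact realComputes_splitStep_one _
    -- The scale two levels up is reached by rescaling the unshifted transform, which closes the
    -- system after two scalings.
    · exact (realComputes_scaledFourier_add_two (d := 1) le_rfl
        (realComputes_scaledFourier_rescale hn0 2) hn (T := 20)
        fun k _ => realComputes_splitStep _ _ _).mono (le_of_eq (by push_cast; ring))

/-! ### The discrete Fourier transform -/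

/-- The position of an input, as an integer modulo `2 ^ n`. -/
def SplitIndex.position : (n : ℕ) → SplitIndex n → ℤ
  | 0, _ => 0
  | 1, b => cond b 1 0
  | n + 2, Sum.inl j => 2 * position (n + 1) j
  | n + 2, Sum.inr (Sum.inl j) => 4 * position n j + 1
  | n + 2, Sum.inr (Sum.inr j) => 4 * position n j - 1

/-- Positions in the three classes are even, `1` and `-1` modulo four, so different classes never
agree modulo `2 ^ (n + 2)`; within a class the claim descends to a shorter length. -/
theorem SplitIndex.eq_of_dvd : (n : ℕ) → (i j : SplitIndex n) →
    (2 ^ n : ℤ) ∣ position n i - position n j → i = j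
  | 0, _, _, _ => rfl
  | 1, i, j, h => by
    revert h
    cases i <;> cases j <;> simp [position] <;> rfl
  | n + 2, i, j, ⟨d, hd⟩ => by
    have e : (2 : ℤ) ^ (n + 2) * d = 4 * (2 ^ n * d) := by ring
    have e' : (2 : ℤ) ^ (n + 1) * d = 2 * (2 ^ n * d) := by ring
    rw [e] at hd
    rcases i with i | i | i <;> rcases j with j | j | j <;> simp only [position] at hd
    · exact congrArg Sum.inl (eq_of_dvd (n + 1) i j ⟨d, by lia⟩)
    · lia
    · lia
    · lia
    · exact congrArg (fun a => Sum.inr (Sum.inl a)) (eq_of_dvd n i j ⟨d, by lia⟩)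
    · lia
    · lia
    · lia
    · exact congrArg (fun a => Sum.inr (Sum.inr a)) (eq_of_dvd n i j ⟨d, by lia⟩)

theorem SplitIndex.exists_equiv (n : ℕ) :
    ∃ e : SplitIndex n ≃ Fin (2 ^ n), ∀ j, ∃ d : ℤ, position n j = (e j : ℕ) + 2 ^ n * d := by
  have hpos : (0 : ℤ) < 2 ^ n := by positivity
  let f : SplitIndex n → Fin (2 ^ n) := fun j =>
    ⟨(position n j % 2 ^ n).toNat, by
      have := Int.emod_lt_of_pos (position n j) hpos
      zify
      rw [Int.toNat_of_nonneg (Int.emod_nonneg _ hpos.ne')]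
      exact this⟩
  have hf (j) : ((f j : ℕ) : ℤ) = position n j % 2 ^ n :=
    Int.toNat_of_nonneg (Int.emod_nonneg _ hpos.ne')
  have hinj : Function.Injective f := by
    intro i j hij
    refine eq_of_dvd n i j (Int.ModEq.dvd (n := 2 ^ n) ?_)
    rw [Int.ModEq, ← hf, ← hf, hij]
  have hbij : Function.Bijective f :=
    (Fintype.bijective_iff_injective_and_card f).2 ⟨hinj, by rw [SplitIndex.card, Fintype.card_fin]⟩
  refine ⟨Equiv.ofBijective f hbij, fun j => ⟨position n j / 2 ^ n, ?_⟩⟩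
  rw [Equiv.ofBijective_apply, hf, Int.emod_add_mul_ediv]

/-- The root of unity `exp (-2 π i z / 2 ^ n)`. -/
noncomputable def dyadicRoot (n : ℕ) (z : ℤ) : ℂ :=
  Complex.exp (-2 * Real.pi * Complex.I / (2 ^ n : ℕ)) ^ z

theorem dyadicRoot_add (n : ℕ) (y z : ℤ) :
    dyadicRoot n (y + z) = dyadicRoot n y * dyadicRoot n z :=
  zpow_add₀ (Complex.exp_ne_zero _) _ _

theorem dyadicRoot_period_mul (n : ℕ) (z : ℤ) : dyadicRoot n (2 ^ n * z) = 1 := by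
  rw [dyadicRoot, ← Complex.exp_int_mul, Complex.exp_eq_one_iff]
  refine ⟨-z, ?_⟩
  push_cast
  field_simp

theorem dyadicRoot_two_mul (n : ℕ) (z : ℤ) : dyadicRoot (n + 1) (2 * z) = dyadicRoot n z := by
  rw [dyadicRoot, dyadicRoot, ← Complex.exp_int_mul, ← Complex.exp_int_mul]
  congr 1
  push_cast
  rw [pow_succ]
  field_simp

theorem dyadicRoot_natCast (n k : ℕ) :
    dyadicRoot n k = Real.cos (dyadicAngle n k) - Complex.I * Real.sin (dyadicAngle n k) := by
  rw [dyadicRoot, ← Complex.exp_int_mul]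
  have h : ((k : ℤ) : ℂ) * (-2 * Real.pi * Complex.I / (2 ^ n : ℕ)) =
      ((-dyadicAngle n k : ℝ) : ℂ) * Complex.I := by
    unfold dyadicAngle
    push_cast
    ring
  rw [h, Complex.exp_mul_I, ← Complex.ofReal_cos, ← Complex.ofReal_sin, Real.cos_neg,
    Real.sin_neg]
  push_cast
  ring

theorem dyadicRoot_neg_natCast (n k : ℕ) :
    dyadicRoot n (-k) = Real.cos (dyadicAngle n k) + Complex.I * Real.sin (dyadicAngle n k) := by
  rw [dyadicRoot, ← Complex.exp_int_mul]
  have h : ((-k : ℤ) : ℂ) * (-2 * Real.pi * Complex.I / (2 ^ n : ℕ)) =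
      (dyadicAngle n k : ℂ) * Complex.I := by
    unfold dyadicAngle
    push_cast
    ring
  rw [h, Complex.exp_mul_I, ← Complex.ofReal_cos, ← Complex.ofReal_sin]
  ring

open SplitIndex in
-- By induction both odd parts become sums over the same index. Collecting the terms of each class
-- turns the cosine and sine back into `cos θ ∓ i * sin θ`, the two conjugate roots.
theorem splitFourier_splitButterfly (k : ℕ) : (n : ℕ) → (y : SplitIndex n → ℂ) →
    splitFourier n (splitButterfly n y) k = ∑ j, dyadicRoot n (k * position n j) * y j
  | 0, y => by
    refine Eq.trans ?_ (Fintype.sum_unique (ι := Unit) _).symm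
    simp [dyadicRoot, position, splitFourier, splitButterfly]
  | 1, y => by
    refine Eq.trans ?_ (Fintype.sum_bool _).symm
    have h : dyadicRoot 1 1 = -1 := by
      have := dyadicRoot_natCast 1 1
      simpa [dyadicAngle] using this
    have h1 : dyadicRoot 1 k = (-1) ^ k := by
      rw [← h, dyadicRoot, dyadicRoot, zpow_natCast, zpow_one]
    simp only [position, splitFourier, splitButterfly, cond_true, cond_false, mul_one, mul_zero, h1]
    simp [dyadicRoot, add_comm]
  | n + 2, y => by
    rw [sum_add_two]
    have e0 (p : ℤ) : dyadicRoot (n + 2) (k * (2 * p)) = dyadicRoot (n + 1) (k * p) := by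
      rw [← dyadicRoot_two_mul (n + 1)]
      ring_nf
    have e1 (p : ℤ) : dyadicRoot (n + 2) (k * (4 * p)) = dyadicRoot n (k * p) := by
      rw [← dyadicRoot_two_mul n, mul_left_comm (2 : ℤ), ← e0]
      ring_nf
    have e2 (p : ℤ) : dyadicRoot (n + 2) (k * (4 * p + 1)) =
        dyadicRoot n (k * p) * dyadicRoot (n + 2) k := by
      rw [mul_add, dyadicRoot_add, e1, mul_one]
    have e3 (p : ℤ) : dyadicRoot (n + 2) (k * (4 * p - 1)) =
        dyadicRoot n (k * p) * dyadicRoot (n + 2) (-k) := by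
      rw [mul_sub, sub_eq_add_neg, dyadicRoot_add, e1, mul_one]
    simp only [splitFourier, splitButterfly, Sum.elim_inl, Sum.elim_inr]
    simp only [splitFourier_splitButterfly k n, splitFourier_splitButterfly k (n + 1), position,
      e0, e2, e3, dyadicRoot_natCast, dyadicRoot_neg_natCast]
    refine congrArg _ ?_
    rw [Finset.mul_sum, Finset.mul_sum, Finset.mul_sum, ← Finset.sum_sub_distrib,
      ← Finset.sum_add_distrib]
    refine Finset.sum_congr rfl fun j _ => ?_
    ring

theorem dftMatrix_mulVec_eq {n : ℕ} (e : SplitIndex n ≃ Fin (2 ^ n))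
    (he : ∀ j, ∃ d : ℤ, SplitIndex.position n j = (e j : ℕ) + 2 ^ n * d)
    (x : Fin (2 ^ n) → ℂ) (k : Fin (2 ^ n)) :
    (dftMatrix (2 ^ n)).mulVec x k = splitFourier n (splitButterfly n (x ∘ e)) k := by
  rw [splitFourier_splitButterfly, Matrix.mulVec, dotProduct, ← e.sum_comp]
  refine Finset.sum_congr rfl fun j _ => ?_
  obtain ⟨d, hd⟩ := he j
  have h : dyadicRoot n (k * SplitIndex.position n j) = dyadicRoot n (k * (e j : ℕ)) := by
    rw [hd, mul_add, dyadicRoot_add, mul_left_comm, dyadicRoot_period_mul, mul_one]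
  rw [h, Function.comp_apply, dyadicRoot, dftMatrix]
  congr 1

theorem dftComputable_of_whtComputable {M : CircuitModel} {c : ℝ} (h : WHTComputable M ℝ c) :
    DFTComputable M (2 / 3 * c + 28 / 9) := by
  have hc := h.nonneg
  obtain ⟨C, h⟩ := h
  -- `2 * C` comes from the input stage, `2` from the scaled transform and `2` from undoing the
  -- scaling of the outputs.
  refine ⟨2 * C + 4, fun n => ?_⟩
  obtain ⟨e, he⟩ := SplitIndex.exists_equiv n
  have h1 := (realComputes_splitButterfly hc h n).precomp e
  have h2 := realComputes_scale ((realComputes_scaledFourier M n).1.comp h1)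
    fun k : Fin (2 ^ n) => twiddleScale n k
  obtain ⟨A, hA, hf, hcost⟩ := h2
  refine ⟨A, hA, fun x => ?_, hcost.trans (le_of_eq ?_)⟩
  · refine (hf (toParts x)).trans ?_
    change toParts _ = toParts _
    congr 1
    funext k
    have h0 : ((twiddleScale n k : ℝ) : ℂ) ≠ 0 := by exact_mod_cast twiddleScale_ne_zero _ _
    rw [dftMatrix_mulVec_eq e he, ofParts_toParts]
    simp only [scaledFourier, add_zero]
    push_cast
    field_simp
  · simp
    ring

theorem lemma1p3 (M : CircuitModel) :
    (∀ c : ℝ, WHTComputable M ℝ c → DFTComputable M (2 / 3 * c + 28 / 9)) ∧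
    (WHTComputable M ℝ 1 ∧ DFTComputable M (34 / 9)) := by
  refine ⟨fun c => dftComputable_of_whtComputable, whtComputable_one M, ?_⟩
  have h := dftComputable_of_whtComputable (whtComputable_one M)
  norm_num at h
  exact h
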